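/- For $r\in(0,1)$ put $r'=\sqrt{1-r^2}$, let $$\mathcal K(r)=\int_0^1\frac{dx}{\sqrt{(1-x^2)(1-r^2x^2)}},\qquad \mu(r)=\frac{\pi}{2}\,\frac{\mathcal K(r')}{\mathcal K(r)},$$ so that $\mu$ is a decreasing homeomorphism of $(0,1)$ onto $(0,\infty)$, and for $K>0$ let $\varphi_K(r)=\mu^{-1}(\mu(r)/K)$. Define $$u_1(r)=\operatorname{artanh}\big((r')^{1/4}\big),\qquad v_2(r)=\log\frac{2(1+r')}{r},\qquad r\in(0,1),$$ and let $u_1^{-1}$, $v_2^{-1}$ denote the inverses of these (injective) functions on $(0,1)$, defined on the images $u_1((0,1))$ and $v_2((0,1))$ respectively. Lemma. (a) For every $K>1$ there is $r_0\in(0,1)$ such that both $u_1^{-1}(u_1(r)/K)$ and $v_2^{-1}(v_2(r)/K)$ are defined for all $r\in(0,r_0)$. For every $K>1$ and every $r\in(0,1)$, $$u_1^{-1}\big(u_1(r)/K\big)<\varphi_K(r)<v_2^{-1}\big(v_2(r)/K\big),$$ where each of the two inequalities holds whenever the inverse value occurring in it is defined. (b) The first inequality is sharp in the sense that, for every $r\in(0,1)$,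 $u_1^{-1}(u_1(r)/K)\to r$ as $K\to1$. -/

import Mathlib

open Real Set Filter Topology

noncomputable section

/-- The complementary modulus `r' = √(1 - r²)`. -/
def compMod (r : ℝ) : ℝ := √(1 - r ^ 2)

/-- The complete elliptic integral of the first kind,
`𝒦(r) = ∫₀¹ dx / √((1 - x²)(1 - r²x²))`. -/
def ellipticK (r : ℝ) : ℝ :=
  ∫ x in (0 : ℝ)..1, 1 / √((1 - x ^ 2) * (1 - r ^ 2 * x ^ 2))

/-- `μ(r) = (π / 2) 𝒦(r') / 𝒦(r)`, a decreasing homeomorphism of `(0, 1)` onto `(0, ∞)`. -/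
def grotzschMu (r : ℝ) : ℝ := π / 2 * (ellipticK (compMod r) / ellipticK r)

/-- The inverse of a function regarded as a function on `(0, 1)`. It is meaningful exactly at the
points of the image of `(0, 1)`, see `InvDefined`. -/
def invOn01 (f : ℝ → ℝ) : ℝ → ℝ := Function.invFunOn f (Ioo 0 1)

/-- `f⁻¹(y)` is defined, where `f` is regarded as a function on `(0, 1)`. -/
def InvDefined (f : ℝ → ℝ) (y : ℝ) : Prop := y ∈ f '' Ioo 0 1

/-- `φ_K(r) = μ⁻¹(μ(r) / K)`. -/
def phi (K r : ℝ) : ℝ := invOn01 grotzschMu (grotzschMu r / K)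

/-- `u₁(r) = arth (r')^{1/4}`. -/
def u₁ (r : ℝ) : ℝ := artanh (compMod r ^ (1 / 4 : ℝ))

/-- `v₂(r) = log (2 (1 + r') / r)`. -/
def v₂ (r : ℝ) : ℝ := log (2 * (1 + compMod r) / r)

end

/-!
Write `r' = √(1 - r²)` and `s = φ_K(r)`, so that `μ(s) = μ(r) / K` and `r < s`. Comparing `u₁` and
`v₂` at `s` with `u₁(r) / K` and `v₂(r) / K` shows that the two bounds say precisely that `u₁ / μ`
is strictly decreasing and `v₂ / μ` is strictly increasing on `(0, 1)`
(`strictAntiOn_u₁_div_grotzschMu`, `strictMonoOn_v₂_div_grotzschMu`). The remaining claims follow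
from the explicit inverses `u₁⁻¹(y) = √(1 - tanh⁸ y)` and `v₂⁻¹(y) = 1 / cosh (y - log 2)`.

Both monotonicity statements rest on the derivative `μ'(r) = -π² / (4 r r'² 𝒦(r)²)`
(`hasDerivAt_grotzschMu`), a consequence of Legendre's relation, and on the representation
`𝒦(r) = J(r')` with `J(c) = ∫₀^∞ dt / √((1 + t²)(1 + c²t²))` (`halfLineK`). The latter gives
Landen's transformation, by a rational substitution, and elementary bounds for `𝒦`: it is
symmetric under `t ↦ 1 / (c t)`, so `J(c)` is twice the integral over `(0, 1 / √c)`, where the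
second factor lies between `1` and `1 + c`.

For `v₂ = log 2 + artanh r'` the sign of the derivative of `v₂ / μ` is that of
`π² v₂ - 4 r' 𝒦² μ`. It is positive because `4 r' 𝒦² < π²` and `μ ≤ v₂`; the latter holds since
`v₂ - μ` is increasing, by `4 r' 𝒦² < π²` again, and has nonnegative limit at `0`.

For `u₁` the ratio of derivatives `u₁' / μ'` is not monotone, so l'Hôpital's monotone rule is not
available directly. Instead, let `l = (1 - √r') / (1 + √r')`, an increasing function of `r`. Two
Landen steps give `4 μ(r) = μ(l²)`, while `2 u₁(r) = artanh l'`. Hence it suffices that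
`artanh l' / μ(l²)` is decreasing, which amounts to
`π artanh l' < 𝒦(l²) 𝒦(√(1 - l⁴)) l' (1 + l²)`. With `𝒦(l²) ≥ π / 2` and
`𝒦(√(1 - l⁴)) ≥ 2 arsinh(1 / l) / √(1 + l²) = 2 artanh(y) / √(1 + l²)`, where `y = 1 / √(1 + l²)`,
this reduces to `artanh(l') / l' < artanh(y) / y`, and `l' < y` because `(1 - l²)(1 + l²) < 1`.
-/

open MeasureTheory

/-! ### The elliptic integral over a half-line -/

/-- The algebraic form `∫₀^∞ dt / √((1 + t²)(1 + c²t²))` of the complete elliptic integral,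
as a function of the complementary modulus `c`; it equals `π / 2` divided by the
arithmetic-geometric mean of `1` and `c`. -/
noncomputable def halfLineK (c : ℝ) : ℝ :=
  ∫ t in Ioi (0 : ℝ), 1 / √((1 + t ^ 2) * (1 + c ^ 2 * t ^ 2))

lemma compMod_pos {r : ℝ} (hr : r ∈ Ioo (0 : ℝ) 1) : 0 < compMod r :=
  sqrt_pos.2 (by nlinarith [hr.1, hr.2])

lemma compMod_sq {r : ℝ} (hr : r ∈ Ioo (0 : ℝ) 1) : compMod r ^ 2 = 1 - r ^ 2 :=
  sq_sqrt (by nlinarith [hr.1, hr.2])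

lemma compMod_mem {r : ℝ} (hr : r ∈ Ioo (0 : ℝ) 1) : compMod r ∈ Ioo (0 : ℝ) 1 := by
  have h1 := compMod_pos hr
  have h2 := compMod_sq hr
  have h3 : 0 < r ^ 2 := pow_pos hr.1 2
  exact ⟨h1, by nlinarith⟩

lemma compMod_compMod {r : ℝ} (hr : r ∈ Ioo (0 : ℝ) 1) : compMod (compMod r) = r := by
  rw [compMod, compMod_sq hr, sub_sub_cancel, sqrt_sq hr.1.le]

/-- The substitution `x = t / √(1 + t²)`. -/
lemma ellipticK_eq_halfLineK {r : ℝ} (hr : r ∈ Ioo (0 : ℝ) 1) :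
    ellipticK r = halfLineK (compMod r) := by
  have himg : (fun t : ℝ => t / √(1 + t ^ 2)) '' Ioi 0 = Ioo 0 1 := by
    ext y
    constructor
    · rintro ⟨t, ht, rfl⟩
      have ht : 0 < t := ht
      have h : 0 < √(1 + t ^ 2) := by positivity
      refine ⟨by positivity, ?_⟩
      rw [div_lt_one h]
      exact lt_sqrt_of_sq_lt (by linarith)
    · rintro ⟨h0, h1⟩
      have h2 : 0 < 1 - y ^ 2 := by nlinarith
      refine ⟨y / √(1 - y ^ 2), by simp only [mem_Ioi]; positivity, ?_⟩
      have h3 : 1 + (y / √(1 - y ^ 2)) ^ 2 = 1 / (1 - y ^ 2) := by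
        rw [div_pow, sq_sqrt h2.le]; field_simp; ring
      simp only [h3]
      rw [sqrt_div zero_le_one, sqrt_one]
      field_simp
  have hder : ∀ t ∈ Ioi (0 : ℝ), HasDerivWithinAt (fun t : ℝ => t / √(1 + t ^ 2))
      (1 / ((1 + t ^ 2) * √(1 + t ^ 2))) (Ioi 0) t := by
    intro t _
    have hp : 0 < 1 + t ^ 2 := by positivity
    have h1 : HasDerivAt (fun t : ℝ => √(1 + t ^ 2)) (t / √(1 + t ^ 2)) t := by
      have := ((hasDerivAt_pow 2 t).const_add 1).sqrt hp.ne'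
      refine this.congr_deriv ?_
      simp only [Nat.cast_ofNat]
      field_simp
      simp
    refine (((hasDerivAt_id t).div h1 (by positivity)).congr_deriv ?_).hasDerivWithinAt
    have h2 : √(1 + t ^ 2) ^ 2 = 1 + t ^ 2 := sq_sqrt hp.le
    simp only [id]
    field_simp
    rw [h2]
    ring
  have hinj : InjOn (fun t : ℝ => t / √(1 + t ^ 2)) (Ioi 0) := by
    intro s hs t ht h
    have hs : 0 < s := hs
    have ht : 0 < t := ht
    have h2 : (s / √(1 + s ^ 2)) ^ 2 = (t / √(1 + t ^ 2)) ^ 2 := by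
      simp only at h; rw [h]
    rw [div_pow, div_pow, sq_sqrt (by positivity), sq_sqrt (by positivity),
      div_eq_div_iff (by positivity) (by positivity)] at h2
    exact (sq_eq_sq₀ hs.le ht.le).1 (by linarith)
  rw [ellipticK, intervalIntegral.integral_of_le zero_le_one, integral_Ioc_eq_integral_Ioo,
    ← himg, integral_image_eq_integral_abs_deriv_smul measurableSet_Ioi hder hinj, halfLineK]
  refine setIntegral_congr_fun measurableSet_Ioi fun t ht => ?_
  have hp : 0 < 1 + t ^ 2 := by positivity
  have h1 : 1 - (t / √(1 + t ^ 2)) ^ 2 = 1 / (1 + t ^ 2) := by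
    rw [div_pow, sq_sqrt hp.le]; field_simp; ring
  have h2 : 1 - r ^ 2 * (t / √(1 + t ^ 2)) ^ 2 = (1 + compMod r ^ 2 * t ^ 2) / (1 + t ^ 2) := by
    rw [div_pow, sq_sqrt hp.le, compMod_sq hr]; field_simp; ring
  have h3 : 0 < 1 + compMod r ^ 2 * t ^ 2 := by positivity
  have h4 : √(1 + t ^ 2) ^ 2 = 1 + t ^ 2 := sq_sqrt hp.le
  simp only [h1, h2, smul_eq_mul]
  rw [abs_of_pos (by positivity), div_mul_div_comm (1 : ℝ) (1 + t ^ 2), one_mul,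
    sqrt_div h3.le,
    sqrt_mul_self hp.le, sqrt_mul hp.le]
  field_simp

lemma grotzschMu_eq {r : ℝ} (hr : r ∈ Ioo (0 : ℝ) 1) :
    grotzschMu r = π / 2 * (halfLineK r / halfLineK (compMod r)) := by
  rw [grotzschMu, ellipticK_eq_halfLineK (compMod_mem hr), compMod_compMod hr,
    ellipticK_eq_halfLineK hr]

/-- Landen's (equivalently Gauss's) transformation, from the substitution
`t = (c x - 1 / x) / (2 √c)`, which maps `(0, ∞)` onto the whole line. -/
lemma halfLineK_landen {c : ℝ} (hc : 0 < c) :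
    halfLineK c = 2 / (1 + c) * halfLineK (2 * √c / (1 + c)) := by
  set f : ℝ → ℝ := fun x => (c * x - x⁻¹) / (2 * √c) with hf
  have hsc : 0 < √c := sqrt_pos.2 hc
  have hsq : √c ^ 2 = c := sq_sqrt hc.le
  have himg : f '' Ioi 0 = univ := by
    refine eq_univ_of_forall fun t => ⟨(t + √(t ^ 2 + 1)) / √c, ?_, ?_⟩
    · have : |t| < √(t ^ 2 + 1) := by
        rw [← sqrt_sq_eq_abs]; exact sqrt_lt_sqrt (sq_nonneg t) (by linarith)
      have h2 : 0 < t + √(t ^ 2 + 1) := by linarith [neg_abs_le t]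
      exact div_pos h2 hsc
    · have : |t| < √(t ^ 2 + 1) := by
        rw [← sqrt_sq_eq_abs]; exact sqrt_lt_sqrt (sq_nonneg t) (by linarith)
      have h2 : 0 < t + √(t ^ 2 + 1) := by linarith [neg_abs_le t]
      have h3 : √(t ^ 2 + 1) ^ 2 = t ^ 2 + 1 := sq_sqrt (by positivity)
      simp only [hf]
      field_simp
      rw [hsq]
      field_simp
      linear_combination h3
  have hder : ∀ x ∈ Ioi (0 : ℝ), HasDerivWithinAt f ((c + 1 / x ^ 2) / (2 * √c)) (Ioi 0) x := by
    intro x hx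
    have hx : 0 < x := hx
    have h := (((hasDerivAt_id x).const_mul c).sub (hasDerivAt_inv hx.ne')).div_const (2 * √c)
    exact (h.congr_deriv (by simp)).hasDerivWithinAt
  have hinj : InjOn f (Ioi 0) := by
    refine StrictMonoOn.injOn fun x hx y hy hxy => ?_
    have hx : 0 < x := hx
    have h1 : y⁻¹ < x⁻¹ := inv_strictAnti₀ hx hxy
    have h2 : c * x < c * y := mul_lt_mul_of_pos_left hxy hc
    exact div_lt_div_of_pos_right (by linarith) (by positivity)
  set k : ℝ := 2 * √c / (1 + c) with hk
  have h1 : ∫ t, 1 / √((1 + t ^ 2) * (1 + k ^ 2 * t ^ 2)) = 2 * halfLineK k := by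
    rw [halfLineK, ← integral_comp_abs]
    simp only [sq_abs]
  have h2 : ∫ t, 1 / √((1 + t ^ 2) * (1 + k ^ 2 * t ^ 2)) = (1 + c) * halfLineK c := by
    rw [← setIntegral_univ, ← himg,
      integral_image_eq_integral_abs_deriv_smul measurableSet_Ioi hder hinj, halfLineK,
      ← integral_const_mul]
    refine setIntegral_congr_fun measurableSet_Ioi fun x hx => ?_
    have hx : 0 < x := hx
    have e1 : 1 + f x ^ 2 = ((c * x + 1 / x) / (2 * √c)) ^ 2 := by
      simp only [hf, div_pow, mul_pow, hsq]; field_simp; ring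
    have e2 : 1 + k ^ 2 * f x ^ 2 = ((1 + x ^ 2) * (1 + c ^ 2 * x ^ 2)) / (x * (1 + c)) ^ 2 := by
      simp only [hf, hk, div_pow, mul_pow, hsq]; field_simp; ring
    simp only [e1, e2, smul_eq_mul]
    rw [abs_of_pos (by positivity), sqrt_mul (by positivity), sqrt_div (by positivity),
      sqrt_sq (by positivity), sqrt_sq (by positivity)]
    have h5 : 0 < √((1 + x ^ 2) * (1 + c ^ 2 * x ^ 2)) := by positivity
    field_simp
  rw [h1] at h2
  field_simp
  linarith

lemma integrableOn_halfLineK {c : ℝ} (hc : 0 < c) :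
    IntegrableOn (fun t : ℝ => 1 / √((1 + t ^ 2) * (1 + c ^ 2 * t ^ 2))) (Ioi 0) := by
  have h := (integrable_inv_one_add_sq.comp_mul_left' (sqrt_pos.2 hc).ne').integrableOn (s := Ioi 0)
  refine Integrable.mono' h ?_ (Eventually.of_forall fun t => ?_)
  · exact (continuous_const.div (by fun_prop) fun t => by positivity).aestronglyMeasurable
  rw [norm_of_nonneg (by positivity), mul_pow, sq_sqrt hc.le, ← one_div]
  refine one_div_le_one_div_of_le (by positivity) (le_sqrt_of_sq_le ?_)
  nlinarith [mul_nonneg (sq_nonneg (1 - c)) (sq_nonneg t)]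

/-- The comparison `(1 + t²)(1 + c²t²) ≥ (1 + c t²)²`; for the arithmetic-geometric mean it says
that the mean of `1` and `c` is at least `√c`. -/
lemma halfLineK_le {c : ℝ} (hc : 0 < c) : halfLineK c ≤ π / (2 * √c) := by
  have hs := sqrt_pos.2 hc
  have h := (integrable_inv_one_add_sq.comp_mul_left' hs.ne').integrableOn (s := Ioi 0)
  have h2 : ∫ t in Ioi (0 : ℝ), (1 + (√c * t) ^ 2)⁻¹ = π / (2 * √c) := by
    rw [integral_comp_mul_left_Ioi (fun t : ℝ => (1 + t ^ 2)⁻¹) 0 hs, mul_zero,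
      integral_Ioi_inv_one_add_sq, arctan_zero, smul_eq_mul]
    field_simp
    ring
  rw [← h2, halfLineK]
  refine setIntegral_mono (integrableOn_halfLineK hc) h fun t => ?_
  simp only
  rw [mul_pow, sq_sqrt hc.le, ← one_div]
  refine one_div_le_one_div_of_le (by positivity) (le_sqrt_of_sq_le ?_)
  nlinarith [mul_nonneg (sq_nonneg (1 - c)) (sq_nonneg t)]

lemma le_halfLineK {c : ℝ} (hc : 0 < c) (hc1 : c ≤ 1) : π / 2 ≤ halfLineK c := by
  have h := integrable_inv_one_add_sq.integrableOn (s := Ioi 0)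
  have h2 : ∫ t in Ioi (0 : ℝ), (1 + t ^ 2)⁻¹ = π / 2 := by
    rw [integral_Ioi_inv_one_add_sq, arctan_zero, sub_zero]
  rw [← h2, halfLineK]
  refine setIntegral_mono h (integrableOn_halfLineK hc) fun t => ?_
  simp only
  rw [← one_div]
  refine one_div_le_one_div_of_le (by positivity) (sqrt_le_iff.2 ⟨by positivity, ?_⟩)
  rw [sq (1 + t ^ 2)]
  have : c ^ 2 * t ^ 2 ≤ t ^ 2 := mul_le_of_le_one_left (sq_nonneg t) (by nlinarith)
  gcongr

lemma halfLineK_pos {c : ℝ} (hc : c ∈ Ioo (0 : ℝ) 1) : 0 < halfLineK c :=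
  lt_of_lt_of_le (by positivity) (le_halfLineK hc.1 hc.2.le)

/-- The involution `t ↦ 1 / (c t)` preserves the integrand and exchanges `(0, 1 / √c)` with
`(1 / √c, ∞)`. -/
lemma halfLineK_eq_two_mul {c : ℝ} (hc : 0 < c) :
    halfLineK c = 2 * ∫ t in (0 : ℝ)..1 / √c, 1 / √((1 + t ^ 2) * (1 + c ^ 2 * t ^ 2)) := by
  have hs := sqrt_pos.2 hc
  have hsq : √c ^ 2 = c := sq_sqrt hc.le
  set a : ℝ := 1 / √c with ha
  have ha0 : 0 < a := by positivity
  set g : ℝ → ℝ := fun t => 1 / √((1 + t ^ 2) * (1 + c ^ 2 * t ^ 2)) with hg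
  have hint : IntegrableOn g (Ioi 0) := integrableOn_halfLineK hc
  have hac : c * a ^ 2 = 1 := by rw [ha, div_pow, hsq]; field_simp
  have himg : (fun t : ℝ => 1 / (c * t)) '' Ioi a = Ioo 0 a := by
    ext y
    constructor
    · rintro ⟨t, ht, rfl⟩
      have ht : a < t := ht
      have ht0 : 0 < t := ha0.trans ht
      refine ⟨by positivity, ?_⟩
      simp only
      rw [div_lt_iff₀ (by positivity)]
      nlinarith [mul_pos hc ha0]
    · rintro ⟨h0, h1⟩
      refine ⟨1 / (c * y), ?_, by field_simp⟩
      simp only [mem_Ioi]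
      rw [lt_div_iff₀ (by positivity)]
      nlinarith [mul_pos hc ha0]
  have hder : ∀ t ∈ Ioi a, HasDerivWithinAt (fun t : ℝ => 1 / (c * t)) (-(1 / (c * t ^ 2)))
      (Ioi a) t := by
    intro t ht
    have ht : a < t := ht
    have ht0 : 0 < t := ha0.trans ht
    have h := ((hasDerivAt_id t).const_mul c).inv (by simp; grind)
    have hfun : (fun t : ℝ => 1 / (c * t)) = (fun y => c * id y)⁻¹ := by ext; simp
    rw [hfun]
    exact (h.congr_deriv (by simp only [id]; field_simp)).hasDerivWithinAt
  have hinj : InjOn (fun t : ℝ => 1 / (c * t)) (Ioi a) := by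
    intro s hs t ht h
    have hs : 0 < s := ha0.trans hs
    have ht : 0 < t := ha0.trans ht
    simp only at h
    field_simp at h
    exact h.symm
  have hrefl : ∫ t in Ioo 0 a, g t = ∫ t in Ioi a, g t := by
    rw [← himg, integral_image_eq_integral_abs_deriv_smul measurableSet_Ioi hder hinj]
    refine setIntegral_congr_fun measurableSet_Ioi fun t ht => ?_
    have ht0 : 0 < t := ha0.trans ht
    have e : (1 + (1 / (c * t)) ^ 2) * (1 + c ^ 2 * (1 / (c * t)) ^ 2) =
        ((1 + t ^ 2) * (1 + c ^ 2 * t ^ 2)) / (c * t ^ 2) ^ 2 := by field_simp; ring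
    simp only [hg, e, smul_eq_mul]
    rw [abs_neg, abs_of_pos (by positivity), sqrt_div (by positivity), sqrt_sq (by positivity)]
    have h5 : 0 < √((1 + t ^ 2) * (1 + c ^ 2 * t ^ 2)) := by positivity
    field_simp
  rw [intervalIntegral.integral_of_le ha0.le, halfLineK, ← Ioc_union_Ioi_eq_Ioi ha0.le,
    setIntegral_union (Ioc_disjoint_Ioi le_rfl) measurableSet_Ioi
      (hint.mono_set Ioc_subset_Ioi_self) (hint.mono_set (Ioi_subset_Ioi ha0.le)),
    integral_Ioc_eq_integral_Ioo, hrefl]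
  ring

lemma integral_one_div_sqrt_one_add_sq (a : ℝ) :
    ∫ t in (0 : ℝ)..a, 1 / √(1 + t ^ 2) = arsinh a := by
  rw [intervalIntegral.integral_eq_sub_of_hasDerivAt
    (f := arsinh) (fun t _ => by simpa using hasDerivAt_arsinh t), arsinh_zero, sub_zero]
  apply Continuous.intervalIntegrable
  exact continuous_const.div (by fun_prop) fun t => by positivity

lemma halfLineK_le_arsinh {c : ℝ} (hc : 0 < c) : halfLineK c ≤ 2 * arsinh (1 / √c) := by
  rw [halfLineK_eq_two_mul hc, ← integral_one_div_sqrt_one_add_sq]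
  have hs := sqrt_pos.2 hc
  refine mul_le_mul_of_nonneg_left (intervalIntegral.integral_mono_on (by positivity)
    (Continuous.intervalIntegrable ?_ _ _) (Continuous.intervalIntegrable ?_ _ _)
    fun t _ => ?_) zero_le_two
  · exact continuous_const.div (by fun_prop) fun t => by positivity
  · exact continuous_const.div (by fun_prop) fun t => by positivity
  · refine one_div_le_one_div_of_le (by positivity) (sqrt_le_sqrt ?_)
    exact le_mul_of_one_le_right (by positivity) (by nlinarith [sq_nonneg (c * t)])

lemma arsinh_le_halfLineK {c : ℝ} (hc : 0 < c) :
    2 / √(1 + c) * arsinh (1 / √c) ≤ halfLineK c := by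
  rw [halfLineK_eq_two_mul hc, ← integral_one_div_sqrt_one_add_sq, div_mul_eq_mul_div,
    mul_div_assoc, ← intervalIntegral.integral_div]
  have hs := sqrt_pos.2 hc
  have hsq : √c ^ 2 = c := sq_sqrt hc.le
  refine mul_le_mul_of_nonneg_left (intervalIntegral.integral_mono_on (by positivity)
    (Continuous.intervalIntegrable ?_ _ _) (Continuous.intervalIntegrable ?_ _ _)
    fun t ht => ?_) zero_le_two
  · exact (continuous_const.div (by fun_prop) fun t => by positivity).div_const _
  · exact continuous_const.div (by fun_prop) fun t => by positivity
  · rw [div_div, ← sqrt_mul (by positivity)]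
    refine one_div_le_one_div_of_le (by positivity) (sqrt_le_sqrt ?_)
    -- on the range of integration `c t² ≤ 1`
    have h1 : t ^ 2 ≤ (1 / √c) ^ 2 := pow_le_pow_left₀ ht.1 ht.2 2
    rw [div_pow, hsq, one_pow, le_div_iff₀ hc] at h1
    refine mul_le_mul_of_nonneg_left ?_ (by positivity)
    nlinarith

/-! ### Legendre's relation and the derivative of `μ` -/

/-- The integrals `∫₀^{π/2} (1 - m sin²θ)^p dθ`, as functions of the parameter `m = r²`:
`p = -1/2` and `p = 1/2` are the complete elliptic integrals of the first and second kind. -/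
noncomputable def trigInt (p m : ℝ) : ℝ := ∫ θ in (0 : ℝ)..π / 2, (1 - m * sin θ ^ 2) ^ p

lemma one_sub_mul_sin_sq_pos {m : ℝ} (hm : m < 1) (θ : ℝ) : 0 < 1 - m * sin θ ^ 2 := by
  rcases le_total 0 m with h | h
  · linarith [mul_le_of_le_one_right h (sin_sq_le_one θ)]
  · linarith [mul_nonpos_of_nonpos_of_nonneg h (sq_nonneg (sin θ))]

lemma continuous_trigInt_integrand {m : ℝ} (hm : m < 1) (p : ℝ) :
    Continuous fun θ => (1 - m * sin θ ^ 2) ^ p :=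
  Continuous.rpow_const (by fun_prop) fun θ => Or.inl (one_sub_mul_sin_sq_pos hm θ).ne'

lemma mul_integral_sin_sq {m : ℝ} (hm : m < 1) (p : ℝ) :
    m * ∫ θ in (0 : ℝ)..π / 2, sin θ ^ 2 * (1 - m * sin θ ^ 2) ^ (p - 1) =
      trigInt (p - 1) m - trigInt p m := by
  rw [trigInt, trigInt, ← intervalIntegral.integral_sub
    ((continuous_trigInt_integrand hm _).intervalIntegrable _ _)
    ((continuous_trigInt_integrand hm _).intervalIntegrable _ _),
    ← intervalIntegral.integral_const_mul]
  congr 1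
  ext θ
  rw [rpow_sub_one (one_sub_mul_sin_sq_pos hm θ).ne' p]
  have := (one_sub_mul_sin_sq_pos hm θ).ne'
  field_simp
  ring

lemma hasDerivAt_trigInt {m : ℝ} (hm : m < 1) (hm0 : 0 < m) (p : ℝ) :
    HasDerivAt (trigInt p) (p * (trigInt p m - trigInt (p - 1) m) / m) m := by
  set a : ℝ := (1 - m) / 2 with ha
  set b : ℝ := 2 with hb
  have ha0 : 0 < a := by rw [ha]; linarith
  have hb0 : 0 < b := by positivity
  have hs : Ioo (m - 1) ((1 + m) / 2) ∈ 𝓝 m := Ioo_mem_nhds (by linarith) (by linarith)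
  have hw : ∀ x ∈ Ioo (m - 1) ((1 + m) / 2), ∀ θ, a ≤ 1 - x * sin θ ^ 2 ∧
      1 - x * sin θ ^ 2 ≤ b := by
    intro x hx θ
    have h1 := sq_nonneg (sin θ)
    have h2 := sin_sq_le_one θ
    constructor
    · have h3 : x * sin θ ^ 2 ≤ (1 + m) / 2 * sin θ ^ 2 := mul_le_mul_of_nonneg_right hx.2.le h1
      have h4 : (1 + m) / 2 * sin θ ^ 2 ≤ (1 + m) / 2 := mul_le_of_le_one_right (by linarith) h2
      rw [ha]; linarith
    · have h3 : -1 * sin θ ^ 2 ≤ x * sin θ ^ 2 :=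
        mul_le_mul_of_nonneg_right (by linarith [hx.1]) h1
      rw [hb]; linarith
  have hlt : ∀ x ∈ Ioo (m - 1) ((1 + m) / 2), x < 1 := fun x hx => by linarith [hx.2]
  have key := (intervalIntegral.hasDerivAt_integral_of_dominated_loc_of_deriv_le
    (μ := volume) (a := 0) (b := π / 2)
    (F := fun x θ => (1 - x * sin θ ^ 2) ^ p)
    (F' := fun x θ => -p * (sin θ ^ 2 * (1 - x * sin θ ^ 2) ^ (p - 1)))
    (bound := fun _ => |p| * (a ^ (p - 1) + b ^ (p - 1))) hs
    (by
      filter_upwards [hs] with x hx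
      exact (continuous_trigInt_integrand (hlt x hx) p).aestronglyMeasurable)
    ((continuous_trigInt_integrand hm p).intervalIntegrable _ _)
    (by
      have := continuous_trigInt_integrand hm (p - 1)
      exact (continuous_const.mul ((by fun_prop : Continuous fun θ => sin θ ^ 2).mul
        this)).aestronglyMeasurable)
    (by
      refine Eventually.of_forall fun θ _ x hx => ?_
      obtain ⟨h1, h2⟩ := hw x hx θ
      have h3 : 0 < 1 - x * sin θ ^ 2 := ha0.trans_le h1
      have h4 : (1 - x * sin θ ^ 2) ^ (p - 1) ≤ a ^ (p - 1) + b ^ (p - 1) := by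
        have := rpow_pos_of_pos ha0 (p - 1)
        have := rpow_pos_of_pos hb0 (p - 1)
        rcases le_total 0 (p - 1) with h | h
        · linarith [rpow_le_rpow h3.le h2 h]
        · linarith [rpow_le_rpow_of_nonpos ha0 h1 h]
      rw [norm_mul, norm_neg, norm_eq_abs, norm_of_nonneg (by positivity)]
      refine mul_le_mul_of_nonneg_left (le_trans ?_ h4) (abs_nonneg p)
      exact mul_le_of_le_one_left (by positivity) (sin_sq_le_one θ))
    (continuous_const.intervalIntegrable _ _)
    (by
      refine Eventually.of_forall fun θ _ x hx => ?_
      have h3 : 0 < 1 - x * sin θ ^ 2 := ha0.trans_le (hw x hx θ).1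
      have h5 : HasDerivAt (fun x => 1 - x * sin θ ^ 2) (-(sin θ ^ 2)) x := by
        simpa using ((hasDerivAt_id x).mul_const (sin θ ^ 2)).const_sub 1
      exact (h5.rpow_const (Or.inl h3.ne')).congr_deriv (by ring))).2
  refine key.congr_deriv ?_
  rw [intervalIntegral.integral_const_mul, eq_div_iff hm0.ne']
  linear_combination (-p) * mul_integral_sin_sq hm p

/-- The recurrence in the exponent, from integrating the derivative of
`sin θ cos θ (1 - m sin²θ)^(-1/2)`, which vanishes at both ends. -/
lemma one_sub_mul_trigInt {m : ℝ} (hm : m < 1) :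
    (1 - m) * trigInt (-1 / 2 - 1) m = trigInt (1 / 2) m := by
  have hder : ∀ θ ∈ uIcc 0 (π / 2), HasDerivAt
      (fun θ => m * (sin θ * cos θ * (1 - m * sin θ ^ 2) ^ (-1 / 2 : ℝ)))
      ((1 - m * sin θ ^ 2) ^ (1 / 2 : ℝ) - (1 - m) * (1 - m * sin θ ^ 2) ^ (-1 / 2 - 1 : ℝ)) θ := by
    intro θ _
    have hw := one_sub_mul_sin_sq_pos hm θ
    have h1 : HasDerivAt (fun θ => 1 - m * sin θ ^ 2) (-(m * (2 * sin θ * cos θ))) θ := by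
      have := (((hasDerivAt_sin θ).fun_pow 2).const_mul m).const_sub 1
      simpa using this
    have h2 := h1.rpow_const (p := (-1 / 2 : ℝ)) (Or.inl hw.ne')
    refine ((((hasDerivAt_sin θ).mul (hasDerivAt_cos θ)).mul h2).const_mul m).congr_deriv ?_
    have e1 : (1 - m * sin θ ^ 2) ^ (1 / 2 : ℝ) =
        (1 - m * sin θ ^ 2) ^ 2 * (1 - m * sin θ ^ 2) ^ (-1 / 2 - 1 : ℝ) := by
      rw [← rpow_two (1 - m * sin θ ^ 2), ← rpow_add hw]; norm_num
    have e2 : (1 - m * sin θ ^ 2) ^ (-1 / 2 : ℝ) =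
        (1 - m * sin θ ^ 2) * (1 - m * sin θ ^ 2) ^ (-1 / 2 - 1 : ℝ) := by
      nth_rewrite 2 [← rpow_one (1 - m * sin θ ^ 2)]
      rw [← rpow_add hw]; norm_num
    have e3 : cos θ ^ 2 = 1 - sin θ ^ 2 := cos_sq' θ
    simp only [Pi.mul_apply, e1, e2]
    generalize (1 - m * sin θ ^ 2) ^ (-1 / 2 - 1 : ℝ) = y
    linear_combination (m * y * (1 - m * sin θ ^ 2) + m ^ 2 * sin θ ^ 2 * y) * e3
  have h1 := (continuous_trigInt_integrand hm (1 / 2)).intervalIntegrable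
    (μ := volume) 0 (π / 2)
  have h2 := ((continuous_trigInt_integrand hm (-1 / 2 - 1)).const_mul (1 - m)).intervalIntegrable
    (μ := volume) 0 (π / 2)
  have h3 := intervalIntegral.integral_eq_sub_of_hasDerivAt hder (h1.sub h2)
  rw [intervalIntegral.integral_sub h1 h2, intervalIntegral.integral_const_mul] at h3
  simp only [sin_zero, cos_pi_div_two] at h3
  simp only [trigInt]
  linarith

lemma hasDerivAt_secondKind {m : ℝ} (hm : m < 1) (hm0 : 0 < m) :
    HasDerivAt (trigInt (1 / 2)) ((trigInt (1 / 2) m - trigInt (-1 / 2) m) / (2 * m)) m := by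
  refine (hasDerivAt_trigInt hm hm0 (1 / 2)).congr_deriv ?_
  norm_num
  field_simp

lemma hasDerivAt_firstKind {m : ℝ} (hm : m < 1) (hm0 : 0 < m) :
    HasDerivAt (trigInt (-1 / 2))
      ((trigInt (1 / 2) m / (1 - m) - trigInt (-1 / 2) m) / (2 * m)) m := by
  refine (hasDerivAt_trigInt hm hm0 (-1 / 2)).congr_deriv ?_
  rw [← one_sub_mul_trigInt hm]
  have : 1 - m ≠ 0 := by linarith
  field_simp
  ring

lemma continuous_secondKind : Continuous (trigInt (1 / 2)) := by
  refine intervalIntegral.continuous_parametric_intervalIntegral_of_continuous' ?_ 0 (π / 2)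
  exact Continuous.rpow_const (by fun_prop) fun _ => Or.inr (by norm_num)

lemma secondKind_one : trigInt (1 / 2) 1 = 1 := by
  have : trigInt (1 / 2) 1 = ∫ θ in (0 : ℝ)..π / 2, cos θ := by
    refine intervalIntegral.integral_congr fun θ hθ => ?_
    rw [uIcc_of_le (by positivity)] at hθ
    have : 0 ≤ cos θ := cos_nonneg_of_mem_Icc ⟨by linarith [hθ.1, pi_pos], hθ.2⟩
    rw [one_mul, ← cos_sq', ← sqrt_eq_rpow, sqrt_sq this]
  rw [this, integral_cos, sin_pi_div_two, sin_zero, sub_zero]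

lemma trigInt_le {p m C : ℝ} (hm : m < 1)
    (h : ∀ θ, (1 - m * sin θ ^ 2) ^ p ≤ C) : trigInt p m ≤ π / 2 * C := by
  calc trigInt p m ≤ ∫ _ in (0 : ℝ)..π / 2, C :=
        intervalIntegral.integral_mono_on (by positivity)
          ((continuous_trigInt_integrand hm p).intervalIntegrable _ _)
          (continuous_const.intervalIntegrable _ _) fun θ _ => h θ
    _ = π / 2 * C := by simp

lemma firstKind_le {m : ℝ} (h0 : 0 ≤ m) (h1 : m < 1) :
    trigInt (-1 / 2) m ≤ π / 2 * (1 - m) ^ (-1 / 2 : ℝ) := by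
  refine trigInt_le h1 fun θ => rpow_le_rpow_of_nonpos (by linarith) ?_ (by norm_num)
  linarith [mul_le_of_le_one_right h0 (sin_sq_le_one θ)]

lemma le_firstKind {m : ℝ} (h0 : 0 ≤ m) (h1 : m < 1) : π / 2 ≤ trigInt (-1 / 2) m := by
  calc π / 2 = ∫ _ in (0 : ℝ)..π / 2, (1 : ℝ) := by simp
    _ ≤ trigInt (-1 / 2) m :=
      intervalIntegral.integral_mono_on (by positivity)
        (continuous_const.intervalIntegrable _ _)
        ((continuous_trigInt_integrand h1 _).intervalIntegrable _ _) fun θ _ =>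
          one_le_rpow_of_pos_of_le_one_of_nonpos (one_sub_mul_sin_sq_pos h1 θ)
            (by nlinarith [sq_nonneg (sin θ)]) (by norm_num)

/-- `0 ≤ K - E ≤ m K`. -/
lemma firstKind_sub_secondKind {m : ℝ} (h0 : 0 ≤ m) (h1 : m < 1) :
    0 ≤ trigInt (-1 / 2) m - trigInt (1 / 2) m ∧
      trigInt (-1 / 2) m - trigInt (1 / 2) m ≤ m * trigInt (-1 / 2) m := by
  have h := mul_integral_sin_sq h1 (1 / 2)
  rw [show (1 / 2 - 1 : ℝ) = -1 / 2 by norm_num] at h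
  rw [← h]
  have hc := continuous_trigInt_integrand h1 (-1 / 2)
  constructor
  · refine mul_nonneg h0 (intervalIntegral.integral_nonneg (by positivity) fun θ _ => ?_)
    have := rpow_nonneg (one_sub_mul_sin_sq_pos h1 θ).le (-1 / 2)
    positivity
  · refine mul_le_mul_of_nonneg_left (intervalIntegral.integral_mono_on (by positivity)
      (((by fun_prop : Continuous fun θ => sin θ ^ 2).mul hc).intervalIntegrable _ _)
      (hc.intervalIntegrable _ _) fun θ _ => ?_) h0
    exact mul_le_of_le_one_left (rpow_nonneg (one_sub_mul_sin_sq_pos h1 θ).le _) (sin_sq_le_one θ)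

lemma tendsto_firstKind_zero : Tendsto (trigInt (-1 / 2)) (𝓝[>] 0) (𝓝 (π / 2)) := by
  have h : ∀ᶠ m : ℝ in 𝓝[>] 0, 0 < m ∧ m < 1 :=
    (Ioo_mem_nhdsGT zero_lt_one)
  refine tendsto_of_tendsto_of_tendsto_of_le_of_le' (h := fun m => π / 2 * (1 - m) ^ (-1 / 2 : ℝ))
    tendsto_const_nhds ?_ ?_ ?_
  · have : ContinuousAt (fun m : ℝ => π / 2 * (1 - m) ^ (-1 / 2 : ℝ)) 0 :=
      continuousAt_const.mul ((by fun_prop : ContinuousAt (fun m : ℝ => 1 - m) 0).rpow_const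
        (Or.inl (by norm_num)))
    have h2 := this.tendsto
    simp only [sub_zero, one_rpow, mul_one] at h2
    exact h2.mono_left nhdsWithin_le_nhds
  · filter_upwards [h] with m hm using le_firstKind hm.1.le hm.2
  · filter_upwards [h] with m hm using firstKind_le hm.1.le hm.2

/-- Legendre's relation `E K' + E' K - K K' = π / 2`: the left side has zero derivative, and its
value is found in the limit `m → 0`. -/
lemma legendre_relation {m : ℝ} (hm : m ∈ Ioo (0 : ℝ) 1) :
    trigInt (1 / 2) m * trigInt (-1 / 2) (1 - m) + trigInt (1 / 2) (1 - m) * trigInt (-1 / 2) m -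
      trigInt (-1 / 2) m * trigInt (-1 / 2) (1 - m) = π / 2 := by
  set W : ℝ → ℝ := fun m => trigInt (1 / 2) m * trigInt (-1 / 2) (1 - m) +
    trigInt (1 / 2) (1 - m) * trigInt (-1 / 2) m - trigInt (-1 / 2) m * trigInt (-1 / 2) (1 - m)
    with hW
  have hder : ∀ x ∈ Ioo (0 : ℝ) 1, HasDerivAt W 0 x := by
    intro x hx
    have h0 : 0 < x := hx.1
    have h1 : 0 < 1 - x := by linarith [hx.2]
    have hs : HasDerivAt (fun x : ℝ => 1 - x) (-1) x := by
      simpa using (hasDerivAt_id x).const_sub 1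
    have hE := hasDerivAt_secondKind hx.2 h0
    have hK := hasDerivAt_firstKind hx.2 h0
    have hE' := (hasDerivAt_secondKind (by linarith [hx.1] : 1 - x < 1) h1).comp x hs
    have hK' := (hasDerivAt_firstKind (by linarith [hx.1] : 1 - x < 1) h1).comp x hs
    refine (((hE.mul hK').add (hE'.mul hK)).sub (hK.mul hK')).congr_deriv ?_
    simp only [Function.comp_apply, sub_sub_cancel]
    field_simp
    ring
  have hconst : ∀ x ∈ Ioo (0 : ℝ) 1, W x = W m := fun x hx =>
    isOpen_Ioo.is_const_of_deriv_eq_zero isPreconnected_Ioo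
      (fun y hy => (hder y hy).differentiableAt.differentiableWithinAt)
      (fun y hy => (hder y hy).deriv) hx hm
  have hev : ∀ᶠ x : ℝ in 𝓝[>] 0, x ∈ Ioo (0 : ℝ) 1 := Ioo_mem_nhdsGT zero_lt_one
  have hlim1 : Tendsto (fun x => trigInt (1 / 2) (1 - x) * trigInt (-1 / 2) x) (𝓝[>] 0)
      (𝓝 (π / 2)) := by
    have h1 : Tendsto (fun x => trigInt (1 / 2) (1 - x)) (𝓝[>] 0) (𝓝 1) := by
      have h : Continuous fun x : ℝ => trigInt (1 / 2) (1 - x) :=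
        continuous_secondKind.comp (by fun_prop)
      have h2 := h.tendsto 0
      rw [sub_zero, secondKind_one] at h2
      exact h2.mono_left nhdsWithin_le_nhds
    simpa using h1.mul tendsto_firstKind_zero
  have hlim2 : Tendsto (fun x => (trigInt (-1 / 2) x - trigInt (1 / 2) x) *
      trigInt (-1 / 2) (1 - x)) (𝓝[>] 0) (𝓝 0) := by
    have hup : Tendsto (fun x : ℝ => √x * trigInt (-1 / 2) x * (π / 2)) (𝓝[>] 0) (𝓝 0) := by
      have h1 : Tendsto (fun x : ℝ => √x) (𝓝[>] 0) (𝓝 0) := by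
        have := continuous_sqrt.tendsto 0
        rw [sqrt_zero] at this
        exact this.mono_left nhdsWithin_le_nhds
      simpa using (h1.mul tendsto_firstKind_zero).mul_const (π / 2)
    refine tendsto_of_tendsto_of_tendsto_of_le_of_le' tendsto_const_nhds hup ?_ ?_
    · filter_upwards [hev] with x hx
      exact mul_nonneg (firstKind_sub_secondKind hx.1.le hx.2).1
        (le_trans (by positivity) (le_firstKind (by linarith [hx.2]) (by linarith [hx.1])))
    · filter_upwards [hev] with x hx
      have h1 := (firstKind_sub_secondKind hx.1.le hx.2).2
      have h2 := firstKind_le (m := 1 - x) (by linarith [hx.2]) (by linarith [hx.1])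
      have h3 : 0 ≤ trigInt (-1 / 2) x := le_trans (by positivity) (le_firstKind hx.1.le hx.2)
      have h4 : 0 ≤ trigInt (-1 / 2) (1 - x) :=
        le_trans (by positivity) (le_firstKind (by linarith [hx.2]) (by linarith [hx.1]))
      have hx0 := hx.1.le
      refine (mul_le_mul h1 h2 h4 (by positivity)).trans (le_of_eq ?_)
      have e : x * x ^ (-1 / 2 : ℝ) = √x := by
        rw [sqrt_eq_rpow]
        nth_rewrite 1 [← rpow_one x]
        rw [← rpow_add hx.1]; norm_num
      rw [sub_sub_cancel, ← e]
      ring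
  have hlim : Tendsto W (𝓝[>] 0) (𝓝 (π / 2)) := by
    have := hlim1.sub hlim2
    rw [sub_zero] at this
    refine this.congr fun x => ?_
    simp only [hW]
    ring
  have hlim' : Tendsto W (𝓝[>] 0) (𝓝 (W m)) :=
    tendsto_const_nhds.congr' (by filter_upwards [hev] with x hx using (hconst x hx).symm)
  exact tendsto_nhds_unique hlim' hlim

/-- The substitution `x = sin θ`. -/
lemma ellipticK_eq_trigInt {r : ℝ} (hr : r ∈ Ioo (0 : ℝ) 1) :
    ellipticK r = trigInt (-1 / 2) (r ^ 2) := by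
  have hr2 : r ^ 2 < 1 := by nlinarith [hr.1, hr.2]
  have himg : sin '' Ioo 0 (π / 2) = Ioo 0 1 := by
    ext y
    constructor
    · rintro ⟨t, ht, rfl⟩
      refine mem_Ioo.2 ⟨sin_pos_of_pos_of_lt_pi ht.1 (by linarith [ht.2, pi_pos]), ?_⟩
      rw [← sin_pi_div_two]
      exact sin_lt_sin_of_lt_of_le_pi_div_two (by linarith [ht.1, pi_pos]) le_rfl ht.2
    · rintro ⟨h0, h1⟩
      exact ⟨arcsin y, ⟨arcsin_pos.2 h0, arcsin_lt_pi_div_two.2 h1⟩,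
        sin_arcsin (by linarith) h1.le⟩
  have hinj : InjOn sin (Ioo 0 (π / 2)) := injOn_sin.mono fun x hx =>
    mem_Icc.2 ⟨by linarith [hx.1, pi_pos], hx.2.le⟩
  rw [ellipticK, intervalIntegral.integral_of_le zero_le_one, integral_Ioc_eq_integral_Ioo,
    ← himg, integral_image_eq_integral_abs_deriv_smul measurableSet_Ioo
      (fun x _ => (hasDerivAt_sin x).hasDerivWithinAt) hinj, trigInt,
    intervalIntegral.integral_of_le (by positivity), integral_Ioc_eq_integral_Ioo]
  refine setIntegral_congr_fun measurableSet_Ioo fun t ht => ?_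
  have hc : 0 < cos t := cos_pos_of_mem_Ioo ⟨by linarith [ht.1, pi_pos], ht.2⟩
  have hw := one_sub_mul_sin_sq_pos hr2 t
  simp only [smul_eq_mul]
  rw [abs_of_pos hc, ← cos_sq', sqrt_mul (sq_nonneg _), sqrt_sq hc.le, neg_div,
    rpow_neg hw.le, ← sqrt_eq_rpow]
  have : 0 < √(1 - r ^ 2 * sin t ^ 2) := sqrt_pos.2 hw
  field_simp

lemma ellipticK_pos {r : ℝ} (hr : r ∈ Ioo (0 : ℝ) 1) : 0 < ellipticK r := by
  rw [ellipticK_eq_halfLineK hr]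
  exact halfLineK_pos (compMod_mem hr)

lemma grotzschMu_pos {r : ℝ} (hr : r ∈ Ioo (0 : ℝ) 1) : 0 < grotzschMu r := by
  have := ellipticK_pos hr
  have := ellipticK_pos (compMod_mem hr)
  rw [grotzschMu]
  positivity

lemma hasDerivAt_grotzschMu {r : ℝ} (hr : r ∈ Ioo (0 : ℝ) 1) :
    HasDerivAt grotzschMu (-(π ^ 2 / (4 * r * (1 - r ^ 2) * ellipticK r ^ 2))) r := by
  have hm : r ^ 2 ∈ Ioo (0 : ℝ) 1 := ⟨pow_pos hr.1 2, by nlinarith [hr.1, hr.2]⟩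
  have h0 : 0 < r ^ 2 := hm.1
  have hr0 : r ≠ 0 := hr.1.ne'
  have h1 : 0 < 1 - r ^ 2 := by linarith [hm.2]
  have hEq : grotzschMu =ᶠ[𝓝 r] fun s =>
      π / 2 * (trigInt (-1 / 2) (1 - s ^ 2) / trigInt (-1 / 2) (s ^ 2)) := by
    filter_upwards [Ioo_mem_nhds hr.1 hr.2] with s hs
    rw [grotzschMu, ellipticK_eq_trigInt hs, ellipticK_eq_trigInt (compMod_mem hs), compMod_sq hs]
  refine HasDerivAt.congr_of_eventuallyEq ?_ hEq
  have hsq : HasDerivAt (fun s : ℝ => s ^ 2) (2 * r) r := by simpa using hasDerivAt_pow 2 r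
  have hK := HasDerivAt.comp (h := fun s : ℝ => s ^ 2) r (hasDerivAt_firstKind hm.2 h0) hsq
  have hK' := HasDerivAt.comp (h := fun s : ℝ => 1 - s ^ 2) r
    (hasDerivAt_firstKind (by linarith [hm.1] : 1 - r ^ 2 < 1) h1) (hsq.const_sub 1)
  have hpos : trigInt (-1 / 2) (r ^ 2) ≠ 0 := by
    rw [← ellipticK_eq_trigInt hr]; exact (ellipticK_pos hr).ne'
  refine ((hK'.div hK hpos).const_mul (π / 2)).congr_deriv ?_
  have hL := legendre_relation hm
  simp only [Function.comp_apply, sub_sub_cancel, ellipticK_eq_trigInt hr]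
  generalize trigInt (-1 / 2) (r ^ 2) = K at *
  generalize trigInt (-1 / 2) (1 - r ^ 2) = K' at *
  generalize trigInt (1 / 2) (r ^ 2) = E at *
  generalize trigInt (1 / 2) (1 - r ^ 2) = E' at *
  field_simp
  linear_combination (-4) * hL

/-! ### The comparison function `artanh r'` -/

lemma compMod_eq {r s : ℝ} (hs : 0 ≤ s) (h : s ^ 2 = 1 - r ^ 2) : compMod r = s := by
  rw [compMod, ← h, sqrt_sq hs]

lemma hasDerivAt_compMod {r : ℝ} (hr : r ∈ Ioo (0 : ℝ) 1) :
    HasDerivAt compMod (-r / compMod r) r := by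
  have h1 : 1 - r ^ 2 ≠ 0 := by nlinarith [hr.1, hr.2]
  have := ((hasDerivAt_pow 2 r).const_sub 1).sqrt h1
  refine this.congr_deriv ?_
  have h2 := compMod_pos hr
  change _ / (2 * compMod r) = _
  field_simp
  simp

lemma artanh_compMod {r : ℝ} (hr : r ∈ Ioo (0 : ℝ) 1) :
    artanh (compMod r) = log ((1 + compMod r) / r) := by
  have h1 := compMod_mem hr
  have h2 := compMod_sq hr
  have hr0 := hr.1
  have h3 : 1 - compMod r ≠ 0 := by linarith [h1.2]
  have h4 : 0 < 1 + compMod r := by linarith [h1.1]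
  have : (1 + compMod r) / (1 - compMod r) = ((1 + compMod r) / r) ^ 2 := by
    field_simp
    linear_combination h2
  rw [artanh, this, sqrt_sq (by positivity)]

lemma hasDerivAt_artanh_compMod {r : ℝ} (hr : r ∈ Ioo (0 : ℝ) 1) :
    HasDerivAt (fun s => artanh (compMod s)) (-(1 / (r * compMod r))) r := by
  have hr0 := hr.1
  have h1 := compMod_pos hr
  have h2 := compMod_sq hr
  have hEq : (fun s => artanh (compMod s)) =ᶠ[𝓝 r] fun s => log ((1 + compMod s) / s) := by
    filter_upwards [Ioo_mem_nhds hr.1 hr.2] with s hs using artanh_compMod hs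
  refine HasDerivAt.congr_of_eventuallyEq ?_ hEq
  have h4 : 0 < 1 + compMod r := by linarith
  refine ((((hasDerivAt_compMod hr).const_add 1).fun_div (hasDerivAt_id' r) hr0.ne').log
    (by positivity)).congr_deriv ?_
  field_simp
  linear_combination (-1 : ℝ) * h2

lemma v₂_eq {r : ℝ} (hr : r ∈ Ioo (0 : ℝ) 1) : v₂ r = log 2 + artanh (compMod r) := by
  have hr0 := hr.1
  have h1 := compMod_pos hr
  rw [v₂, artanh_compMod hr, mul_div_assoc, log_mul two_ne_zero (by positivity)]

lemma hasDerivAt_v₂ {r : ℝ} (hr : r ∈ Ioo (0 : ℝ) 1) :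
    HasDerivAt v₂ (-(1 / (r * compMod r))) r := by
  refine ((hasDerivAt_artanh_compMod hr).const_add (log 2)).congr_of_eventuallyEq ?_
  filter_upwards [Ioo_mem_nhds hr.1 hr.2] with s hs using v₂_eq hs

lemma hasDerivAt_artanh {y : ℝ} (hy : y ∈ Ioo (-1 : ℝ) 1) :
    HasDerivAt artanh (1 / (1 - y ^ 2)) y := by
  have h1 : 0 < 1 + y := by linarith [hy.1]
  have h2 : 0 < 1 - y := by linarith [hy.2]
  have hEq : artanh =ᶠ[𝓝 y] fun s => 1 / 2 * log ((1 + s) / (1 - s)) := by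
    filter_upwards [Ioo_mem_nhds hy.1 hy.2] with s hs
    exact artanh_eq_half_log (Ioo_subset_Icc_self hs)
  refine HasDerivAt.congr_of_eventuallyEq ?_ hEq
  refine (((((hasDerivAt_id' y).const_add 1).fun_div ((hasDerivAt_id' y).const_sub 1) h2.ne').log
    (by positivity)).const_mul (1 / 2)).congr_deriv ?_
  have h3 : 1 - y ^ 2 = (1 - y) * (1 + y) := by ring
  rw [h3]
  field_simp
  ring

lemma strictMonoOn_artanh_div_self :
    StrictMonoOn (fun y => artanh y / y) (Ioo (0 : ℝ) 1) := by
  have hd : ∀ y ∈ Ioo (0 : ℝ) 1, HasDerivAt (fun y => artanh y / y)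
      ((1 / (1 - y ^ 2) * y - artanh y * 1) / y ^ 2) y := fun y hy =>
    (hasDerivAt_artanh ⟨by linarith [hy.1], hy.2⟩).fun_div (hasDerivAt_id' y) hy.1.ne'
  refine strictMonoOn_of_hasDerivWithinAt_pos (convex_Ioo 0 1)
    (fun y hy => (hd y hy).continuousAt.continuousWithinAt)
    (fun y hy => (hd y (interior_subset hy)).hasDerivWithinAt) fun y hy => ?_
  rw [interior_Ioo] at hy
  have hy' : y ∈ Ioo (-1 : ℝ) 1 := ⟨by linarith [hy.1], hy.2⟩
  have h1 : 0 < 1 - y ^ 2 := by nlinarith [hy.1, hy.2]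
  -- with `y = tanh z` this is `z < sinh z cosh z = sinh (2z) / 2`
  have h2 : 2 * artanh y < sinh (2 * artanh y) :=
    self_lt_sinh_iff.2 (mul_pos two_pos (artanh_pos hy))
  rw [sinh_two_mul, sinh_artanh hy', cosh_artanh hy'] at h2
  have h3 : 2 * (y / √(1 - y ^ 2)) * (1 / √(1 - y ^ 2)) = 2 * (1 / (1 - y ^ 2) * y) := by
    nth_rewrite 3 [← sq_sqrt h1.le]
    field_simp
  have hy0 := hy.1
  exact div_pos (by linarith) (by positivity)

/-! ### Landen's transformation of `μ` and of `u₁` -/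

lemma landen_mem {t : ℝ} (ht : t ∈ Ioo (0 : ℝ) 1) : (1 - t) / (1 + t) ∈ Ioo (0 : ℝ) 1 := by
  obtain ⟨h0, h1⟩ := ht
  refine ⟨div_pos (by linarith) (by linarith), ?_⟩
  rw [div_lt_one (by linarith)]
  linarith

lemma compMod_landen {t : ℝ} (ht : t ∈ Ioo (0 : ℝ) 1) :
    compMod ((1 - t) / (1 + t)) = 2 * √t / (1 + t) := by
  have h0 := ht.1
  refine compMod_eq (by positivity) ?_
  rw [div_pow, mul_pow, sq_sqrt h0.le]
  field_simp
  ring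

/-- A descending Landen step doubles `μ`. -/
lemma grotzschMu_landen {r : ℝ} (hr : r ∈ Ioo (0 : ℝ) 1) :
    grotzschMu ((1 - compMod r) / (1 + compMod r)) = 2 * grotzschMu r := by
  have ht := compMod_mem hr
  have hk := landen_mem ht
  set t := compMod r with htdef
  set k := (1 - t) / (1 + t) with hkdef
  have h0 := ht.1
  have h1 : halfLineK t = 2 / (1 + t) * halfLineK (compMod k) := by
    rw [hkdef, compMod_landen ht]; exact halfLineK_landen h0
  have h2 : halfLineK k = 2 / (1 + k) * halfLineK r := by
    have e : (1 - k) / (1 + k) = t := by rw [hkdef]; field_simp; ring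
    have : r = 2 * √k / (1 + k) := by
      rw [← compMod_landen hk, e, htdef, compMod_compMod hr]
    rw [this]
    exact halfLineK_landen hk.1
  have hp := halfLineK_pos (compMod_mem hk)
  have h3 : 1 + k = 2 / (1 + t) := by rw [hkdef]; field_simp; ring
  rw [grotzschMu_eq hr, grotzschMu_eq hk, ← htdef, h1, h2, h3]
  field_simp

/-- The square root `(1 - √r') / (1 + √r')` of the modulus obtained from `r` by two descending
Landen steps. -/
noncomputable def landenRoot (r : ℝ) : ℝ := (1 - √(compMod r)) / (1 + √(compMod r))

lemma sqrt_compMod_mem {r : ℝ} (hr : r ∈ Ioo (0 : ℝ) 1) : √(compMod r) ∈ Ioo (0 : ℝ) 1 := by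
  have h := compMod_mem hr
  exact ⟨sqrt_pos.2 h.1, (sqrt_lt' one_pos).2 (by simpa using h.2)⟩

lemma landenRoot_mem {r : ℝ} (hr : r ∈ Ioo (0 : ℝ) 1) : landenRoot r ∈ Ioo (0 : ℝ) 1 :=
  landen_mem (sqrt_compMod_mem hr)

lemma sq_mem_Ioo {l : ℝ} (hl : l ∈ Ioo (0 : ℝ) 1) : l ^ 2 ∈ Ioo (0 : ℝ) 1 :=
  ⟨pow_pos hl.1 2, by nlinarith [hl.1, hl.2]⟩

lemma compMod_lt_compMod {r s : ℝ} (hr : r ∈ Ioo (0 : ℝ) 1) (hs : s ∈ Ioo (0 : ℝ) 1)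
    (h : r < s) : compMod s < compMod r :=
  sqrt_lt_sqrt (by nlinarith [hs.1, hs.2]) (by nlinarith [hr.1])

lemma landenRoot_strictMonoOn : StrictMonoOn landenRoot (Ioo 0 1) := by
  intro r hr s hs h
  have h1 := sqrt_compMod_mem hr
  have h2 := sqrt_compMod_mem hs
  have h3 := sqrt_lt_sqrt (compMod_pos hs).le (compMod_lt_compMod hr hs h)
  rw [landenRoot, landenRoot, div_lt_div_iff₀ (by linarith [h1.1]) (by linarith [h2.1])]
  nlinarith

lemma grotzschMu_landenRoot_sq {r : ℝ} (hr : r ∈ Ioo (0 : ℝ) 1) :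
    grotzschMu (landenRoot r ^ 2) = 4 * grotzschMu r := by
  have ht := compMod_mem hr
  have hk := landen_mem ht
  have h := grotzschMu_landen hk
  have hs := (sqrt_compMod_mem hr).1
  have hsq : √(compMod r) ^ 2 = compMod r := sq_sqrt ht.1.le
  have h0 := ht.1
  have e : (1 - compMod ((1 - compMod r) / (1 + compMod r))) /
      (1 + compMod ((1 - compMod r) / (1 + compMod r))) = landenRoot r ^ 2 := by
    rw [compMod_landen ht, landenRoot]
    nth_rewrite 2 4 [← hsq]
    generalize √(compMod r) = x at *
    have h5 : 1 + x ^ 2 + 2 * x ≠ 0 := by positivity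
    field_simp
    ring
  rw [e, grotzschMu_landen hr] at h
  linarith

lemma u₁_eq {r : ℝ} (hr : r ∈ Ioo (0 : ℝ) 1) :
    u₁ r = artanh (compMod (landenRoot r)) / 2 := by
  have ht := compMod_mem hr
  have hs := sqrt_compMod_mem hr
  have hss : √√(compMod r) ∈ Ioo (0 : ℝ) 1 :=
    ⟨sqrt_pos.2 hs.1, (sqrt_lt' one_pos).2 (by simpa using hs.2)⟩
  have e : compMod r ^ (1 / 4 : ℝ) = √√(compMod r) := by
    rw [sqrt_eq_rpow, sqrt_eq_rpow, ← rpow_mul ht.1.le]; norm_num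
  have hsq : √√(compMod r) ^ 2 = √(compMod r) := sq_sqrt hs.1.le
  rw [u₁, e, landenRoot, compMod_landen hs]
  nth_rewrite 3 [← hsq]
  generalize √√(compMod r) = x at hss
  obtain ⟨h0, h1⟩ := hss
  have h2 : 0 < 1 - x := by linarith
  have e2 : (1 + 2 * x / (1 + x ^ 2)) / (1 - 2 * x / (1 + x ^ 2)) = ((1 + x) / (1 - x)) ^ 2 := by
    have h3 : 1 + x ^ 2 - 2 * x ≠ 0 := by nlinarith
    field_simp
    ring
  rw [artanh, artanh, e2, sqrt_sq (by positivity), log_sqrt (by positivity)]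

/-! ### Monotonicity of `u₁ / μ` -/

/-- With `𝒦(l²) ≥ π / 2` and the arsinh bound for `𝒦(√(1 - l⁴))`, the claim reduces to the
monotonicity of `artanh y / y` at `l' < 1 / √(1 + l²)`. -/
lemma pi_mul_artanh_compMod_lt {l : ℝ} (hl : l ∈ Ioo (0 : ℝ) 1) :
    π * artanh (compMod l) <
      ellipticK (l ^ 2) * ellipticK (compMod (l ^ 2)) * (compMod l * (1 + l ^ 2)) := by
  have hl2 := sq_mem_Ioo hl
  obtain ⟨hl0, hl1⟩ := hl
  have hc := compMod_mem ⟨hl0, hl1⟩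
  have hcsq := compMod_sq ⟨hl0, hl1⟩
  set w : ℝ := √(1 + l ^ 2) with hw
  have hw0 : 0 < w := by positivity
  have hwsq : w ^ 2 = 1 + l ^ 2 := sq_sqrt (by positivity)
  have hw1 : 1 < w := by nlinarith
  have hy : 1 / w ∈ Ioo (0 : ℝ) 1 := ⟨by positivity, (div_lt_one hw0).2 hw1⟩
  have hK : π / 2 ≤ ellipticK (l ^ 2) := by
    rw [ellipticK_eq_halfLineK hl2]
    exact le_halfLineK (compMod_mem hl2).1 (compMod_mem hl2).2.le
  have hK' : 2 / w * arsinh (1 / l) ≤ ellipticK (compMod (l ^ 2)) := by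
    rw [ellipticK_eq_halfLineK (compMod_mem hl2), compMod_compMod hl2]
    simpa [sqrt_sq hl0.le] using arsinh_le_halfLineK hl2.1
  have harsinh : artanh (1 / w) = arsinh (1 / l) := by
    rw [← arsinh_sinh (artanh (1 / w)), sinh_artanh ⟨by linarith [hy.1], hy.2⟩]
    have : 1 - (1 / w) ^ 2 = (l / w) ^ 2 := by
      field_simp; linarith
    rw [this, sqrt_sq (by positivity)]
    congr 1
    field_simp
  have hlt : compMod l < 1 / w := by
    rw [lt_div_iff₀ hw0]
    have : (compMod l * w) ^ 2 < 1 := by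
      rw [mul_pow, hcsq, hwsq]; nlinarith [pow_pos hl0 4]
    exact lt_of_pow_lt_pow_left₀ 2 zero_le_one (by simpa using this)
  have hmono := strictMonoOn_artanh_div_self hc hy hlt
  simp only at hmono
  rw [harsinh, div_lt_iff₀ hc.1] at hmono
  have hA : 0 < arsinh (1 / l) := arsinh_pos_iff.2 (by positivity)
  have hc0 := hc.1
  calc π * artanh (compMod l) < π * (arsinh (1 / l) / (1 / w) * compMod l) :=
        mul_lt_mul_of_pos_left hmono pi_pos
    _ = π / 2 * (2 / w * arsinh (1 / l)) * (compMod l * (1 + l ^ 2)) := by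
        rw [← hwsq]; field_simp
    _ ≤ _ := by
        have := ellipticK_pos hl2
        gcongr

lemma strictAntiOn_artanh_compMod_div :
    StrictAntiOn (fun l => artanh (compMod l) / grotzschMu (l ^ 2)) (Ioo 0 1) := by
  have hd : ∀ l ∈ Ioo (0 : ℝ) 1, HasDerivAt (fun l => artanh (compMod l) / grotzschMu (l ^ 2))
      ((-(1 / (l * compMod l)) * grotzschMu (l ^ 2) - artanh (compMod l) *
        (-(π ^ 2 / (4 * l ^ 2 * (1 - (l ^ 2) ^ 2) * ellipticK (l ^ 2) ^ 2)) * (2 * l))) /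
        grotzschMu (l ^ 2) ^ 2) l := by
    intro l hl
    have hsq : HasDerivAt (fun s : ℝ => s ^ 2) (2 * l) l := by simpa using hasDerivAt_pow 2 l
    exact (hasDerivAt_artanh_compMod hl).fun_div
      (HasDerivAt.comp (h := fun s : ℝ => s ^ 2) l (hasDerivAt_grotzschMu (sq_mem_Ioo hl)) hsq)
      (grotzschMu_pos (sq_mem_Ioo hl)).ne'
  refine strictAntiOn_of_hasDerivWithinAt_neg (convex_Ioo 0 1)
    (fun y hy => (hd y hy).continuousAt.continuousWithinAt)
    (fun y hy => (hd y (interior_subset hy)).hasDerivWithinAt) fun l hl => ?_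
  rw [interior_Ioo] at hl
  have hl2 := sq_mem_Ioo hl
  refine div_neg_of_neg_of_pos ?_ (pow_pos (grotzschMu_pos hl2) 2)
  have hkey := pi_mul_artanh_compMod_lt hl
  have hK := ellipticK_pos hl2
  have hc := compMod_pos hl
  have e : 1 - (l ^ 2) ^ 2 = compMod l ^ 2 * (1 + l ^ 2) := by rw [compMod_sq hl]; ring
  have hl0 := hl.1
  rw [grotzschMu, e]
  generalize ellipticK (l ^ 2) = K at *
  generalize ellipticK (compMod (l ^ 2)) = K' at *
  generalize compMod l = c at *
  have : -(1 / (l * c)) * (π / 2 * (K' / K)) -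
      artanh c * (-(π ^ 2 / (4 * l ^ 2 * (c ^ 2 * (1 + l ^ 2)) * K ^ 2)) * (2 * l)) =
      π / (2 * l * c ^ 2 * (1 + l ^ 2) * K ^ 2) *
        (π * artanh c - K * K' * (c * (1 + l ^ 2))) := by
    field_simp
    ring
  rw [this]
  exact mul_neg_of_pos_of_neg (by positivity) (by linarith)

lemma strictAntiOn_u₁_div_grotzschMu :
    StrictAntiOn (fun r => u₁ r / grotzschMu r) (Ioo 0 1) := by
  intro r hr s hs h
  have := strictAntiOn_artanh_compMod_div (landenRoot_mem hr) (landenRoot_mem hs)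
    (landenRoot_strictMonoOn hr hs h)
  simp only [grotzschMu_landenRoot_sq hr, grotzschMu_landenRoot_sq hs] at this
  simp only [u₁_eq hr, u₁_eq hs]
  have h1 := grotzschMu_pos hr
  have h2 := grotzschMu_pos hs
  rw [div_lt_div_iff₀ (by positivity) (by positivity)] at this ⊢
  linarith

/-! ### Monotonicity of `v₂ / μ` -/

/-- The bound `√r' 𝒦(r) ≤ π / 2` at the modulus reached by a Landen step gives a strict bound. -/
lemma compMod_mul_ellipticK_sq_lt {r : ℝ} (hr : r ∈ Ioo (0 : ℝ) 1) :
    4 * (compMod r * ellipticK r ^ 2) < π ^ 2 := by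
  have hc := compMod_mem hr
  rw [ellipticK_eq_halfLineK hr]
  generalize compMod r = c at hc
  obtain ⟨h0, h1⟩ := hc
  have hs : 0 < √c := sqrt_pos.2 h0
  have hsq : √c ^ 2 = c := sq_sqrt h0.le
  have hs1 : √c < 1 := by nlinarith
  have hk : 0 < 2 * √c / (1 + c) := by positivity
  have hK : 0 ≤ halfLineK (2 * √c / (1 + c)) := integral_nonneg fun t => by positivity
  have h2 : halfLineK (2 * √c / (1 + c)) ^ 2 ≤ (π / (2 * √(2 * √c / (1 + c)))) ^ 2 :=
    pow_le_pow_left₀ hK (halfLineK_le hk) 2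
  rw [div_pow, mul_pow, sq_sqrt hk.le] at h2
  rw [halfLineK_landen h0, mul_pow]
  calc 4 * (c * ((2 / (1 + c)) ^ 2 * halfLineK (2 * √c / (1 + c)) ^ 2))
      ≤ 4 * (c * ((2 / (1 + c)) ^ 2 * (π ^ 2 / (2 ^ 2 * (2 * √c / (1 + c)))))) := by gcongr
    _ = π ^ 2 * (2 * √c / (1 + c)) := by
        nth_rewrite 1 [← hsq]
        field_simp
        ring
    _ < π ^ 2 * 1 := by
        refine mul_lt_mul_of_pos_left ?_ (by positivity)
        rw [div_lt_one (by positivity)]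
        nlinarith [sq_nonneg (1 - √c)]
    _ = π ^ 2 := mul_one _

lemma log_le_v₂_sub_grotzschMu {s : ℝ} (hs : s ∈ Ioo (0 : ℝ) 1) :
    log (2 * (1 + compMod s) / (1 + √(1 + s)) ^ 2) ≤ v₂ s - grotzschMu s := by
  have hs0 := hs.1
  have hc := compMod_pos hs
  have hq : 0 < √s := sqrt_pos.2 hs0
  have h1 : grotzschMu s ≤ halfLineK s := by
    have hK : π / 2 ≤ halfLineK (compMod s) :=
      le_halfLineK (compMod_mem hs).1 (compMod_mem hs).2.le
    have hJ := halfLineK_pos hs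
    rw [grotzschMu_eq hs, ← mul_div_assoc, div_le_iff₀ (halfLineK_pos (compMod_mem hs)), mul_comm]
    gcongr
  have h2 : 2 * arsinh (1 / √s) = log ((1 + √(1 + s)) ^ 2 / s) := by
    have e1 : 1 + (1 / √s) ^ 2 = (1 + s) / s := by
      rw [div_pow, sq_sqrt hs0.le]; field_simp; ring
    rw [arsinh, e1, sqrt_div (by positivity), ← add_div, ← log_rpow (by positivity), rpow_two,
      div_pow, sq_sqrt hs0.le]
  have h3 := halfLineK_le_arsinh hs0
  have h4 : log (2 * (1 + compMod s) / (1 + √(1 + s)) ^ 2) =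
      v₂ s - log ((1 + √(1 + s)) ^ 2 / s) := by
    rw [v₂, ← log_div (by positivity) (by positivity)]
    congr 1
    field_simp
  linarith

/-- The difference `v₂ - μ` is increasing, and its limit at `0` is nonnegative. -/
lemma grotzschMu_le_v₂ {r : ℝ} (hr : r ∈ Ioo (0 : ℝ) 1) : grotzschMu r ≤ v₂ r := by
  have hd : ∀ s ∈ Ioo (0 : ℝ) 1, HasDerivAt (fun s => v₂ s - grotzschMu s)
      (-(1 / (s * compMod s)) - -(π ^ 2 / (4 * s * (1 - s ^ 2) * ellipticK s ^ 2))) s :=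
    fun s hs => (hasDerivAt_v₂ hs).sub (hasDerivAt_grotzschMu hs)
  have hmono : MonotoneOn (fun s => v₂ s - grotzschMu s) (Ioo 0 1) := by
    refine monotoneOn_of_hasDerivWithinAt_nonneg (convex_Ioo 0 1)
      (fun y hy => (hd y hy).continuousAt.continuousWithinAt)
      (fun y hy => (hd y (interior_subset hy)).hasDerivWithinAt) fun s hs => ?_
    rw [interior_Ioo] at hs
    have h1 := compMod_mul_ellipticK_sq_lt hs
    have hK := ellipticK_pos hs
    have hc := compMod_pos hs
    have hs0 := hs.1
    rw [← compMod_sq hs, sub_neg_eq_add, neg_add_eq_sub, sub_nonneg,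
      div_le_div_iff₀ (by positivity) (by positivity)]
    have := mul_le_mul_of_nonneg_left h1.le (by positivity : 0 ≤ s * compMod s)
    linarith
  have hlim : Tendsto (fun s => log (2 * (1 + compMod s) / (1 + √(1 + s)) ^ 2)) (𝓝[>] 0)
      (𝓝 0) := by
    have hc : ContinuousAt (fun s => log (2 * (1 + compMod s) / (1 + √(1 + s)) ^ 2)) 0 := by
      refine ContinuousAt.log (ContinuousAt.div ?_ (by fun_prop) (by positivity)) (by simp [compMod])
      unfold compMod
      fun_prop
    have := hc.tendsto
    norm_num [compMod] at this
    simp only [compMod]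
    exact this.mono_left nhdsWithin_le_nhds
  have h0 : 0 ≤ v₂ r - grotzschMu r := by
    refine le_of_tendsto hlim ?_
    filter_upwards [Ioo_mem_nhdsGT hr.1] with s hs
    have hs' : s ∈ Ioo (0 : ℝ) 1 := ⟨hs.1, hs.2.trans hr.2⟩
    exact (log_le_v₂_sub_grotzschMu hs').trans (hmono hs' hr hs.2.le)
  linarith

lemma strictMonoOn_v₂_div_grotzschMu :
    StrictMonoOn (fun r => v₂ r / grotzschMu r) (Ioo 0 1) := by
  have hd : ∀ r ∈ Ioo (0 : ℝ) 1, HasDerivAt (fun r => v₂ r / grotzschMu r)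
      ((-(1 / (r * compMod r)) * grotzschMu r - v₂ r *
        (-(π ^ 2 / (4 * r * (1 - r ^ 2) * ellipticK r ^ 2)))) / grotzschMu r ^ 2) r :=
    fun r hr => (hasDerivAt_v₂ hr).fun_div (hasDerivAt_grotzschMu hr) (grotzschMu_pos hr).ne'
  refine strictMonoOn_of_hasDerivWithinAt_pos (convex_Ioo 0 1)
    (fun y hy => (hd y hy).continuousAt.continuousWithinAt)
    (fun y hy => (hd y (interior_subset hy)).hasDerivWithinAt) fun r hr => ?_
  rw [interior_Ioo] at hr
  have hμ := grotzschMu_pos hr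
  have hv := grotzschMu_le_v₂ hr
  have h1 := compMod_mul_ellipticK_sq_lt hr
  have hK := ellipticK_pos hr
  have hc := compMod_pos hr
  have hr0 := hr.1
  refine div_pos ?_ (by positivity)
  rw [← compMod_sq hr]
  generalize grotzschMu r = M at *
  generalize v₂ r = v at *
  generalize ellipticK r = K at *
  generalize compMod r = c at *
  have : -(1 / (r * c)) * M - v * (-(π ^ 2 / (4 * r * c ^ 2 * K ^ 2))) =
      (v * π ^ 2 - M * (4 * (c * K ^ 2))) / (4 * r * c ^ 2 * K ^ 2) := by
    field_simp
    ring
  rw [this]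
  refine div_pos ?_ (by positivity)
  have h2 : M * (4 * (c * K ^ 2)) < M * π ^ 2 := mul_lt_mul_of_pos_left h1 hμ
  have h3 : M * π ^ 2 ≤ v * π ^ 2 := mul_le_mul_of_nonneg_right hv (by positivity)
  linarith

/-! ### The inverse functions -/

lemma invOn01_spec {f : ℝ → ℝ} {y : ℝ} (h : InvDefined f y) :
    invOn01 f y ∈ Ioo (0 : ℝ) 1 ∧ f (invOn01 f y) = y :=
  ⟨Function.invFunOn_mem h, Function.invFunOn_eq h⟩

lemma strictAntiOn_grotzschMu : StrictAntiOn grotzschMu (Ioo 0 1) := by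
  refine strictAntiOn_of_hasDerivWithinAt_neg (convex_Ioo 0 1)
    (fun y hy => (hasDerivAt_grotzschMu hy).continuousAt.continuousWithinAt)
    (fun y hy => (hasDerivAt_grotzschMu (interior_subset hy)).hasDerivWithinAt) fun r hr => ?_
  rw [interior_Ioo] at hr
  have hK := ellipticK_pos hr
  have hr0 := hr.1
  have h1 : 0 < 1 - r ^ 2 := by nlinarith [hr.1, hr.2]
  rw [neg_lt_zero]
  positivity

/-- Ascending Landen steps halve `μ`. -/
lemma exists_grotzschMu_eq_div_two_pow {r : ℝ} (hr : r ∈ Ioo (0 : ℝ) 1) (n : ℕ) :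
    ∃ s ∈ Ioo (0 : ℝ) 1, grotzschMu s = grotzschMu r / 2 ^ n := by
  induction n with
  | zero => exact ⟨r, hr, by simp⟩
  | succ n ih =>
    obtain ⟨s, hs, h⟩ := ih
    have hk := landen_mem hs
    have h2 := grotzschMu_landen (compMod_mem hk)
    have e : (1 - (1 - s) / (1 + s)) / (1 + (1 - s) / (1 + s)) = s := by
      have := hs.1
      field_simp
      ring
    rw [compMod_compMod hk, e] at h2
    exact ⟨_, compMod_mem hk, by rw [pow_succ, ← div_div, ← h, h2]; ring⟩

lemma invDefined_grotzschMu {K r : ℝ} (hK : 1 < K) (hr : r ∈ Ioo (0 : ℝ) 1) :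
    InvDefined grotzschMu (grotzschMu r / K) := by
  have hμ := grotzschMu_pos hr
  obtain ⟨n, hn⟩ := pow_unbounded_of_one_lt K one_lt_two
  obtain ⟨s, hs, h⟩ := exists_grotzschMu_eq_div_two_pow hr n
  refine isPreconnected_Ioo.intermediate_value hs hr
    (fun y hy => (hasDerivAt_grotzschMu hy).continuousAt.continuousWithinAt) ⟨?_, ?_⟩
  · rw [h]
    exact div_le_div_of_nonneg_left hμ.le (by linarith) hn.le
  · exact div_le_self hμ.le hK.le

lemma strictAntiOn_v₂ : StrictAntiOn v₂ (Ioo 0 1) := by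
  refine strictAntiOn_of_hasDerivWithinAt_neg (convex_Ioo 0 1)
    (fun y hy => (hasDerivAt_v₂ hy).continuousAt.continuousWithinAt)
    (fun y hy => (hasDerivAt_v₂ (interior_subset hy)).hasDerivWithinAt) fun r hr => ?_
  rw [interior_Ioo] at hr
  exact neg_lt_zero.2 (one_div_pos.2 (mul_pos hr.1 (compMod_pos hr)))

lemma compMod_rpow_mem {r : ℝ} (hr : r ∈ Ioo (0 : ℝ) 1) :
    compMod r ^ (1 / 4 : ℝ) ∈ Ioo (0 : ℝ) 1 :=
  have h := compMod_mem hr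
  ⟨rpow_pos_of_pos h.1 _, rpow_lt_one h.1.le h.2 (by norm_num)⟩

lemma strictAntiOn_u₁ : StrictAntiOn u₁ (Ioo 0 1) := by
  intro r hr s hs h
  exact artanh_lt_artanh (by linarith [(compMod_rpow_mem hs).1]) (compMod_rpow_mem hr).2
    (rpow_lt_rpow (compMod_pos hs).le (compMod_lt_compMod hr hs h) (by norm_num))

lemma u₁_pos {r : ℝ} (hr : r ∈ Ioo (0 : ℝ) 1) : 0 < u₁ r := artanh_pos (compMod_rpow_mem hr)

/-- The explicit inverse of `u₁`. -/
lemma u₁_sqrt_one_sub_tanh {y : ℝ} (hy : 0 < y) :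
    √(1 - tanh y ^ 8) ∈ Ioo (0 : ℝ) 1 ∧ u₁ √(1 - tanh y ^ 8) = y := by
  have h0 : 0 < tanh y := by
    rw [tanh_eq_sinh_div_cosh]; exact div_pos (sinh_pos_iff.2 hy) (cosh_pos y)
  have h1 : tanh y < 1 := tanh_lt_one y
  have h2 : 0 < tanh y ^ 8 := by positivity
  have h3 : tanh y ^ 8 < 1 := pow_lt_one₀ h0.le h1 (by norm_num)
  refine ⟨⟨sqrt_pos.2 (by linarith), (sqrt_lt' one_pos).2 (by linarith)⟩, ?_⟩
  have hc : compMod √(1 - tanh y ^ 8) = tanh y ^ 4 :=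
    compMod_eq (by positivity) (by rw [sq_sqrt (by linarith)]; ring)
  rw [u₁, hc, ← rpow_natCast, ← rpow_mul h0.le]
  norm_num [artanh_tanh]

lemma invDefined_u₁ {y : ℝ} (hy : 0 < y) : InvDefined u₁ y :=
  ⟨_, (u₁_sqrt_one_sub_tanh hy).1, (u₁_sqrt_one_sub_tanh hy).2⟩

lemma invOn01_u₁ {y : ℝ} (hy : 0 < y) : invOn01 u₁ y = √(1 - tanh y ^ 8) :=
  have h := invOn01_spec (invDefined_u₁ hy)
  have h' := u₁_sqrt_one_sub_tanh hy
  strictAntiOn_u₁.injOn h.1 h'.1 (h.2.trans h'.2.symm)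

/-- The explicit inverse of `v₂` is `y ↦ 1 / cosh (y - log 2)`. -/
lemma invDefined_v₂ {y : ℝ} (hy : log 2 < y) : InvDefined v₂ y := by
  have hz : 0 < y - log 2 := sub_pos.2 hy
  have hc : 1 < cosh (y - log 2) := one_lt_cosh.2 hz.ne'
  have hr : 1 / cosh (y - log 2) ∈ Ioo (0 : ℝ) 1 :=
    ⟨by positivity, (div_lt_one (by linarith)).2 hc⟩
  have e : compMod (1 / cosh (y - log 2)) = tanh (y - log 2) := by
    rw [tanh_eq_sinh_div_cosh]
    refine compMod_eq (div_pos (sinh_pos_iff.2 hz) (cosh_pos _)).le ?_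
    rw [div_pow, div_pow, sinh_sq, one_pow]
    have := cosh_pos (y - log 2)
    field_simp
  exact ⟨_, hr, by rw [v₂_eq hr, e, artanh_tanh]; ring⟩

lemma tendsto_invOn01_u₁ {r : ℝ} (hr : r ∈ Ioo (0 : ℝ) 1) :
    Tendsto (fun K : ℝ => invOn01 u₁ (u₁ r / K)) (𝓝 1) (𝓝 r) := by
  have hu := u₁_pos hr
  have hcont : ContinuousAt (fun K : ℝ => √(1 - tanh (u₁ r / K) ^ 8)) 1 := by
    have ht : Continuous tanh := by
      simp only [funext tanh_eq_sinh_div_cosh]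
      exact continuous_sinh.div continuous_cosh fun x => (cosh_pos x).ne'
    have h1 : ContinuousAt (fun K : ℝ => u₁ r / K) 1 :=
      continuousAt_const.div continuousAt_id one_ne_zero
    exact (continuousAt_const.sub ((ht.continuousAt.comp h1).pow 8)).sqrt
  have hval : √(1 - tanh (u₁ r) ^ 8) = r :=
    have h := u₁_sqrt_one_sub_tanh hu
    strictAntiOn_u₁.injOn h.1 hr h.2
  have hlim := hcont.tendsto
  simp only [div_one, hval] at hlim
  refine hlim.congr' ?_
  filter_upwards [lt_mem_nhds (zero_lt_one' ℝ)] with K hK using (invOn01_u₁ (by positivity)).symm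

lemma phi_spec {K r : ℝ} (hK : 1 < K) (hr : r ∈ Ioo (0 : ℝ) 1) :
    phi K r ∈ Ioo (0 : ℝ) 1 ∧ grotzschMu (phi K r) = grotzschMu r / K ∧ r < phi K r := by
  obtain ⟨h1, h2⟩ := invOn01_spec (invDefined_grotzschMu hK hr)
  refine ⟨h1, h2, (strictAntiOn_grotzschMu.lt_iff_gt h1 hr).1 ?_⟩
  exact h2.trans_lt (div_lt_self (grotzschMu_pos hr) hK)

theorem mainTheorem5 :
    -- both inverses are defined on some interval `(0, r₀)`
    (∀ K : ℝ, 1 < K → ∃ r₀ ∈ Ioo (0 : ℝ) 1, ∀ r ∈ Ioo 0 r₀,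
      InvDefined u₁ (u₁ r / K) ∧ InvDefined v₂ (v₂ r / K)) ∧
    -- each bound holds wherever it is defined
    (∀ K : ℝ, 1 < K → ∀ r ∈ Ioo (0 : ℝ) 1,
      (InvDefined u₁ (u₁ r / K) → invOn01 u₁ (u₁ r / K) < phi K r) ∧
      (InvDefined v₂ (v₂ r / K) → phi K r < invOn01 v₂ (v₂ r / K))) ∧
    -- sharpness of the lower bound
    (∀ r ∈ Ioo (0 : ℝ) 1,
      Tendsto (fun K : ℝ => invOn01 u₁ (u₁ r / K)) (𝓝 1) (𝓝 r)) := by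
  refine ⟨fun K hK => ?_, fun K hK r hr => ?_, fun r hr => tendsto_invOn01_u₁ hr⟩
  · have hK0 : 0 < K := by linarith
    -- `v₂ r > log (2 / r)`, so `r < 2^(1 - K)` makes `v₂ r / K` exceed `log 2`
    have h2 : (2 : ℝ) ^ (1 - K) ∈ Ioo (0 : ℝ) 1 :=
      ⟨by positivity, rpow_lt_one_of_one_lt_of_neg one_lt_two (by linarith)⟩
    refine ⟨_, h2, fun r hr => ?_⟩
    have hr' : r ∈ Ioo (0 : ℝ) 1 := ⟨hr.1, hr.2.trans h2.2⟩
    refine ⟨invDefined_u₁ (div_pos (u₁_pos hr') hK0), invDefined_v₂ ?_⟩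
    have hc := compMod_pos hr'
    have h3 : log r < (1 - K) * log 2 := by
      rw [← log_rpow two_pos]; exact log_lt_log hr.1 hr.2
    have h4 : 0 < log (1 + compMod r) := log_pos (by linarith)
    rw [lt_div_iff₀ hK0, v₂_eq hr', artanh_compMod hr', log_div (by positivity) hr.1.ne']
    linarith
  · obtain ⟨hs, hμ, hlt⟩ := phi_spec hK hr
    have hK0 : 0 < K := by linarith
    have hμr := grotzschMu_pos hr
    constructor
    · intro hd
      obtain ⟨ht, hu⟩ := invOn01_spec hd
      have h := strictAntiOn_u₁_div_grotzschMu hr hs hlt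
      simp only [hμ] at h
      rw [div_lt_div_iff₀ (by positivity) hμr] at h
      refine (strictAntiOn_u₁.lt_iff_gt hs ht).1 ?_
      rw [hu, lt_div_iff₀ hK0]
      rw [← mul_div_assoc, lt_div_iff₀ hK0] at h
      nlinarith
    · intro hd
      obtain ⟨ht, hv⟩ := invOn01_spec hd
      have h := strictMonoOn_v₂_div_grotzschMu hr hs hlt
      simp only [hμ] at h
      rw [div_lt_div_iff₀ hμr (by positivity)] at h
      refine (strictAntiOn_v₂.lt_iff_gt ht hs).1 ?_
      rw [hv, div_lt_iff₀ hK0]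
      rw [← mul_div_assoc, div_lt_iff₀ hK0] at h
      nlinarith
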